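/- Let $n\ge 1$. For $\alpha=(\alpha^{(j)}_m)_{1\le j\le n,\,1\le m\le 11}$ with entries in $\mathbb F_2$, let $D(\alpha)$ be the $2n\times 10$ matrix over $\mathbb F_2$ obtained by stacking $n$ blocks, the $j$-th block consisting of the two rows $(\alpha^{(j)}_1,\dots,\alpha^{(j)}_{10})$ and $(\alpha^{(j)}_2,\dots,\alpha^{(j)}_{11})$. For $0\le i\le \min(2n,10)$ let $\Gamma_i$ be the number of matrices of this form that have rank $i$. Then, for every such $i$, $\Gamma_i$ is given by the corresponding line of $$\begin{aligned} \Gamma_0&=1,\\ \Gamma_1&=3(2^n-1),\\ \Gamma_2&=7\cdot2^{2n}+2023\cdot2^n-2030,\\ \Gamma_3&=15\cdot2^{3n}+7035\cdot2^{2n}-21210\cdot2^n+14160,\\ \Gamma_4&=31\cdot2^{4n}+17315\cdot2^{3n}+568590\cdot2^{2n}-1827440\cdot2^n+1241504,\\ \Gamma_5&=63\cdot2^{5n}+37107\cdot2^{4n}+1993950\cdot2^{3n}-15266160\cdot2^{2n}+31282272\cdot2^n-18047232,\\ \Gamma_6&=127\cdot2^{6n}+72723\cdot2^{5n}+4120830\cdot2^{4n}-24883824\cdot2^{3n}+18602976\cdot2^{2n}+54302976\cdot2^n-52215808,\\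 \Gamma_7&=255\cdot2^{7n}+127635\cdot2^{6n}+5117310\cdot2^{5n}-67607280\cdot2^{4n}+39863520\cdot2^{3n}+1210256640\cdot2^{2n}\\&\quad-3062415360\cdot2^n+1874657280,\\ \Gamma_8&=511\cdot2^{8n}+171955\cdot2^{7n}-897890\cdot2^{6n}-38376240\cdot2^{5n}+323250144\cdot2^{4n}+271514880\cdot2^{3n}\\&\quad-436135\cdot2^{14}\cdot2^{2n}+242795\cdot2^{16}\cdot2^n-4445\cdot2^{21},\\ \Gamma_9&=1023\cdot2^{9n}-1533\cdot2^{8n}-517650\cdot2^{7n}+1798320\cdot2^{6n}+78214752\cdot2^{5n}-559464192\cdot2^{4n}\\&\quad-783237120\cdot2^{3n}+200235\cdot2^{16}\cdot2^{2n}-106680\cdot2^{18}\cdot2^n+480\cdot2^{25},\\ \Gamma_{10}&=2^{11n}-1023\cdot2^{9n}+1022\cdot2^{8n}+345440\cdot2^{7n}-1028192\cdot2^{6n}-45028608\cdot2^{5n}+299663360\cdot2^{4n}\\&\quad+494731264\cdot2^{3n}-27432\cdot2^{18}\cdot2^{2n}+57344\cdot2^{18}\cdot2^n-256\cdot2^{25}.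 \end{aligned}$$ Moreover, let $R^{(10)}_{4,n}$ be the number of tuples of polynomials $\bigl(Y_i,\,U^{(i)}_j\bigr)_{1\le i\le4,\,1\le j\le n}$ in $\mathbb F_2[T]^{4(n+1)}$ with $\deg Y_i\le 9$ and $\deg U^{(i)}_j\le1$ (the zero polynomial being allowed) such that $\sum_{i=1}^4Y_iU^{(i)}_j=0$ for every $1\le j\le n$. Then $$R^{(10)}_{4,n}=2^{8n}+15345\cdot2^{6n}+107310\cdot2^{5n}+37128000\cdot2^{4n}+329001120\cdot2^{3n}+67088385\cdot2^{8}\cdot2^{2n}+26043255\cdot2^{12}\cdot2^{n}+14881860\cdot2^{16}.$$ -/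

import Mathlib

/-- The `2n × k` matrix over `𝔽₂` (rows indexed by a block `j` and a position `r` in the block)
whose `j`-th block has the two rows `(α₁, …, α_k)` and `(α₂, …, α_{k+1})`, where
`α₁, …, α_{k+1}` is the `j`-th sequence `α j 0, …, α j k`. -/
def nTimesPersymmetric (n k : ℕ) (α : Fin n → Fin (k + 1) → ZMod 2) :
    Matrix (Fin n × Fin 2) (Fin k) (ZMod 2) :=
  Matrix.of fun row c => α row.1 ⟨(c : ℕ) + (row.2 : ℕ), by omega⟩

/-- `Γ_i`: the number of `2n × k` `n`-times persymmetric matrices over `𝔽₂` of rank `i`. -/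
noncomputable def rankCount (n k i : ℕ) : ℕ :=
  {M : Matrix (Fin n × Fin 2) (Fin k) (ZMod 2) |
    (∃ α, M = nTimesPersymmetric n k α) ∧ M.rank = i}.ncard

/-- `R_{q,n}^{(k)}`: the number of tuples `(Y, U)` of polynomials over `𝔽₂` with
`∑ᵢ Yᵢ U_j^{(i)} = 0` for all `j`, where `deg Yᵢ ≤ k - 1` and `deg U_j^{(i)} ≤ 1`
(the zero polynomial is allowed; it has degree `⊥`). -/
noncomputable def solutionCount (q n k : ℕ) : ℕ :=
  {s : (Fin q → Polynomial (ZMod 2)) × (Fin n → Fin q → Polynomial (ZMod 2)) |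
    (∀ i, (s.1 i).degree < (k : WithBot ℕ)) ∧
    (∀ j i, (s.2 j i).degree ≤ (1 : WithBot ℕ)) ∧
    ∀ j, ∑ i, s.1 i * s.2 j i = 0}.ncard

/-- The explicit values of `Γ_i` for ten columns, as polynomials in `2 ^ n`
(for `0 ≤ i ≤ 10`; the value for `i > 10` is irrelevant). -/
def rankFormula (n : ℕ) : ℕ → ℤ
  | 0 => 1
  | 1 => (2 ^ n - 1) * 3
  | 2 => 7 * 2 ^ (2 * n) + 2023 * 2 ^ n - 2030
  | 3 => 15 * 2 ^ (3 * n) + 7035 * 2 ^ (2 * n) - 21210 * 2 ^ n + 14160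
  | 4 => 31 * 2 ^ (4 * n) + 17315 * 2 ^ (3 * n) + 568590 * 2 ^ (2 * n) - 1827440 * 2 ^ n
      + 1241504
  | 5 => 63 * 2 ^ (5 * n) + 37107 * 2 ^ (4 * n) + 1993950 * 2 ^ (3 * n)
      - 15266160 * 2 ^ (2 * n) + 31282272 * 2 ^ n - 18047232
  | 6 => 127 * 2 ^ (6 * n) + 72723 * 2 ^ (5 * n) + 4120830 * 2 ^ (4 * n)
      - 24883824 * 2 ^ (3 * n) + 18602976 * 2 ^ (2 * n) + 54302976 * 2 ^ n - 52215808
  | 7 => 255 * 2 ^ (7 * n) + 127635 * 2 ^ (6 * n) + 5117310 * 2 ^ (5 * n)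
      - 67607280 * 2 ^ (4 * n) + 39863520 * 2 ^ (3 * n) + 1210256640 * 2 ^ (2 * n)
      - 3062415360 * 2 ^ n + 1874657280
  | 8 => 511 * 2 ^ (8 * n) + 171955 * 2 ^ (7 * n) - 897890 * 2 ^ (6 * n)
      - 38376240 * 2 ^ (5 * n) + 323250144 * 2 ^ (4 * n) + 271514880 * 2 ^ (3 * n)
      - 436135 * 2 ^ 14 * 2 ^ (2 * n) + 242795 * 2 ^ 16 * 2 ^ n - 4445 * 2 ^ 21
  | 9 => 1023 * 2 ^ (9 * n) - 1533 * 2 ^ (8 * n) - 517650 * 2 ^ (7 * n)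
      + 1798320 * 2 ^ (6 * n) + 78214752 * 2 ^ (5 * n) - 559464192 * 2 ^ (4 * n)
      - 783237120 * 2 ^ (3 * n) + 200235 * 2 ^ 16 * 2 ^ (2 * n) - 106680 * 2 ^ 18 * 2 ^ n
      + 480 * 2 ^ 25
  | 10 => 2 ^ (11 * n) - 1023 * 2 ^ (9 * n) + 1022 * 2 ^ (8 * n) + 345440 * 2 ^ (7 * n)
      - 1028192 * 2 ^ (6 * n) - 45028608 * 2 ^ (5 * n) + 299663360 * 2 ^ (4 * n)
      + 494731264 * 2 ^ (3 * n) - 27432 * 2 ^ 18 * 2 ^ (2 * n) + 57344 * 2 ^ 18 * 2 ^ n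
      - 256 * 2 ^ 25
  | _ => 0

/-!
A vector in the kernel of the matrix `D(α)` with `k` columns is a polynomial `p` of degree less
than `k` such that all the functionals with coefficient sequences `α⁽ʲ⁾` vanish at `p` and at
`X * p`. A subspace `V` of `𝔽_q[X]_{<k}` is therefore contained in the kernel exactly if every
`α⁽ʲ⁾` annihilates `V + XV`, which happens for `q ^ (n (k + 1 - dim (V + XV)))` families `α`.
Double counting of the pairs `(V, α)` with `dim V = d` gives, for every `d`,

`∑_α [dim ker D(α) choose d] = ∑_V q ^ (n (k + 1 - dim (V + XV)))`

(`sum_gaussBinom_finrank_kernelSpace`). This system is unitriangular in the numbers of matrices of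
given rank (`eq_of_sum_mul_gaussBinom_eq`), so it determines them as soon as the subspaces `V`
have been counted by `dim (V + XV) = 2 d - f`, where `f = dim (V ∩ X⁻¹V)`.

For that count, `U + XU ≤ V` is equivalent to `U ≤ V ∩ X⁻¹V`. Counting the pairs `(U, V)` with
this property in two ways expresses the distribution of `f` in degree less than `k + 1` through
the one in degree less than `k`, again by a unitriangular system (`profileCount_succ`). Its
solution is the closed form `profileFormula`, a power of `q` times two Gaussian binomials; for
`q = 2` and `k ≤ 10` this is a finite computation.

For the polynomial equations over `𝔽₂`, a tuple `Y` of `q` polynomials admits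
`2 ^ (2 q - dim (V + XV))` relations with coefficients of degree at most one, where `V` is the
span of `Y`. Up to a power of `2 ^ n`, the number of solutions is thus the number of pairs
`(Y, α)` with `Y` in the kernel of `D(α)`, which is `∑_i Γ_i 2 ^ (q (k - i))`
(`solutionCount_eq_sum_rankCount`).
-/

open Polynomial Module

/-! ### Gaussian binomial coefficients -/

/-- The Gaussian binomial coefficient `[n choose k]` with parameter `q`, by its Pascal recursion. -/
def gaussBinom (q : ℕ) : ℕ → ℕ → ℕ
  | _, 0 => 1
  | 0, _ + 1 => 0
  | n + 1, k + 1 => gaussBinom q n k + q ^ (k + 1) * gaussBinom q n (k + 1)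

@[simp] theorem gaussBinom_zero_right (q n : ℕ) : gaussBinom q n 0 = 1 := by
  cases n <;> rfl

theorem gaussBinom_eq_zero_of_lt (q : ℕ) {n k : ℕ} (h : n < k) : gaussBinom q n k = 0 := by
  induction n generalizing k with
  | zero => obtain ⟨k, rfl⟩ := Nat.exists_eq_add_one_of_ne_zero h.ne'; rfl
  | succ n ih =>
    obtain ⟨k, rfl⟩ := Nat.exists_eq_add_one_of_ne_zero (Nat.ne_zero_of_lt h)
    simp [gaussBinom, ih (show n < k by omega), ih (show n < k + 1 by omega)]

@[simp] theorem gaussBinom_self (q n : ℕ) : gaussBinom q n n = 1 := by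
  induction n with
  | zero => rfl
  | succ n ih => simp [gaussBinom, ih, gaussBinom_eq_zero_of_lt]

/-- `∏_{i < k} (q ^ (n + 1) - q ^ i)`, with the factor `i = 0` split off and `q` taken out of each
of the others. -/
theorem prod_pow_succ_sub_pow (q : ℤ) (n k : ℕ) :
    ∏ i ∈ Finset.range (k + 1), (q ^ (n + 1) - q ^ i) =
      (q ^ (n + 1) - 1) * (q ^ k * ∏ i ∈ Finset.range k, (q ^ n - q ^ i)) := by
  rw [Finset.prod_range_succ', mul_comm, pow_zero]
  congr 1
  rw [← Finset.card_range k, ← Finset.prod_const, Finset.card_range, ← Finset.prod_mul_distrib]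
  exact Finset.prod_congr rfl fun i _ => by ring

/-- The product formula for `[n choose k]`, cleared of denominators. It also holds for `n < k`,
where the factor `i = n` on the right vanishes. -/
theorem gaussBinom_mul_prod (q n k : ℕ) :
    (gaussBinom q n k : ℤ) * ∏ i ∈ Finset.range k, ((q : ℤ) ^ k - (q : ℤ) ^ i) =
      ∏ i ∈ Finset.range k, ((q : ℤ) ^ n - (q : ℤ) ^ i) := by
  induction n generalizing k with
  | zero =>
    cases k with
    | zero => simp
    | succ k => simp [gaussBinom, Finset.prod_range_succ']
  | succ n ih =>
    cases k with
    | zero => simp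
    | succ k =>
      have h1 := ih (k + 1)
      rw [prod_pow_succ_sub_pow, Finset.prod_range_succ (n := k)] at h1
      rw [prod_pow_succ_sub_pow, prod_pow_succ_sub_pow, ← ih k]
      rw [← ih k] at h1
      simp only [gaussBinom]
      push_cast
      linear_combination (q : ℤ) ^ (k + 1) * h1

/-- The system of linear equations with coefficients `[f choose g]` is unitriangular. -/
theorem eq_of_sum_mul_gaussBinom_eq {q N : ℕ} {a b : ℕ → ℤ}
    (h : ∀ g ≤ N, ∑ f ∈ Finset.range (N + 1), a f * gaussBinom q f g =
      ∑ f ∈ Finset.range (N + 1), b f * gaussBinom q f g) :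
    ∀ f ≤ N, a f = b f := by
  suffices H : ∀ m ≤ N, ∀ f ≤ N, N - m ≤ f → a f = b f from
    fun f hf => H N le_rfl f hf (by omega)
  intro m
  induction m with
  | zero =>
    intro _ f hf hf'
    obtain rfl : f = N := by omega
    have := h f le_rfl
    rw [Finset.sum_range_succ, Finset.sum_range_succ, Finset.sum_eq_zero,
      Finset.sum_eq_zero] at this
    · simpa using this
    all_goals
      intro i hi
      simp [gaussBinom_eq_zero_of_lt q (Finset.mem_range.mp hi)]
  | succ m ih =>
    intro hm f hf hf'
    rcases Nat.lt_or_ge f (N - m) with hlt | hge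
    · have := h f hf
      rw [← sub_eq_zero, ← Finset.sum_sub_distrib, Finset.sum_eq_single f] at this
      · simpa [sub_eq_zero] using this
      · intro i hi hne
        rcases Nat.lt_or_gt_of_ne hne with h' | h'
        · simp [gaussBinom_eq_zero_of_lt q h']
        · rw [ih (by omega) i (by simp at hi; omega) (by omega), sub_self]
      · intro h'
        exact absurd (Finset.mem_range.mpr (by omega)) h'
    · exact ih (by omega) f hf hge

/-! ### Counting subspaces -/

section Subspaces

variable {K V : Type*} [Field K] [Fintype K] [AddCommGroup V] [Module K V]

/-- The ordered bases of a `d`-dimensional `W ≤ V`, viewed inside `V`. -/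
theorem card_linearIndependent_span_eq [Finite V] (W : Submodule K V) {d : ℕ}
    (hW : finrank K W = d) :
    Nat.card {s : Fin d → V // LinearIndependent K s ∧ Submodule.span K (Set.range s) = W} =
      ∏ i : Fin d, (Fintype.card K ^ d - Fintype.card K ^ (i : ℕ)) := by
  have := card_linearIndependent (K := K) (V := W) (k := d) hW.ge
  rw [hW] at this
  rw [← this]
  refine Nat.card_congr
    { toFun := fun s => ⟨fun i => ⟨s.1 i, ?_⟩, ?_⟩
      invFun := fun s => ⟨fun i => s.1 i, ?_, ?_⟩
      left_inv := fun s => rfl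
      right_inv := fun s => rfl }
  · exact s.2.2.le (Submodule.subset_span ⟨i, rfl⟩)
  · exact LinearIndependent.of_comp W.subtype s.2.1
  · exact s.2.map' W.subtype (Submodule.ker_subtype W)
  · have hli := s.2.map' W.subtype (Submodule.ker_subtype W)
    refine Submodule.eq_of_le_of_finrank_eq ?_ ?_
    · rw [Submodule.span_le]
      rintro _ ⟨i, rfl⟩
      exact (s.1 i).2
    · rw [hW]
      exact (finrank_span_eq_card hli).trans (Fintype.card_fin d)

/-- A finite vector space of dimension `n` has `[n choose d]` subspaces of dimension `d`. -/
theorem card_submodule_finrank_eq [Finite V] (d : ℕ) :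
    Nat.card {W : Submodule K V // finrank K W = d} =
      gaussBinom (Fintype.card K) (finrank K V) d := by
  classical
  rcases Nat.lt_or_ge (finrank K V) d with hlt | hge
  · rw [gaussBinom_eq_zero_of_lt _ hlt, Nat.card_eq_zero]
    exact Or.inl ⟨fun W => by have := W.1.finrank_le; have := W.2; omega⟩
  have hq : 1 < Fintype.card K := Fintype.one_lt_card
  have hcount : Nat.card {s : Fin d → V // LinearIndependent K s} =
      Nat.card {W : Submodule K V // finrank K W = d} *
        ∏ i : Fin d, (Fintype.card K ^ d - Fintype.card K ^ (i : ℕ)) := by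
    have e : {s : Fin d → V // LinearIndependent K s} ≃
        Σ W : {W : Submodule K V // finrank K W = d},
          {s : Fin d → V // LinearIndependent K s ∧ Submodule.span K (Set.range s) = W} :=
      { toFun := fun s => ⟨⟨Submodule.span K (Set.range s.1), by
          simpa using finrank_span_eq_card s.2⟩, s.1, s.2, rfl⟩
        invFun := fun x => ⟨x.2.1, x.2.2.1⟩
        left_inv := fun s => rfl
        right_inv := by
          rintro ⟨⟨W, hW⟩, s, hs, h⟩
          obtain rfl : _ = W := h
          rfl }
    have : Fintype {W : Submodule K V // finrank K W = d} := Fintype.ofFinite _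
    rw [Nat.card_congr e, Nat.card_sigma,
      Finset.sum_congr rfl fun W _ => card_linearIndependent_span_eq W.1 W.2]
    simp
  rw [card_linearIndependent hge] at hcount
  have hcast : ∀ m, d ≤ m → ((∏ i : Fin d, (Fintype.card K ^ m - Fintype.card K ^ (i : ℕ)) : ℕ) : ℤ)
      = ∏ i ∈ Finset.range d, ((Fintype.card K : ℤ) ^ m - (Fintype.card K : ℤ) ^ i) := by
    intro m hm
    rw [Finset.prod_range]
    push_cast
    refine Finset.prod_congr rfl fun i _ => ?_
    rw [Nat.cast_sub (Nat.pow_le_pow_right hq.le (by omega))]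
    push_cast
    rfl
  have key := congrArg (Nat.cast : ℕ → ℤ) hcount
  rw [Nat.cast_mul, hcast _ hge, hcast _ le_rfl, ← gaussBinom_mul_prod] at key
  have hne : ∏ i ∈ Finset.range d, ((Fintype.card K : ℤ) ^ d - (Fintype.card K : ℤ) ^ i) ≠ 0 := by
    refine Finset.prod_ne_zero_iff.mpr fun i hi => ?_
    have : (Fintype.card K : ℤ) ^ i < (Fintype.card K : ℤ) ^ d :=
      pow_lt_pow_right₀ (by exact_mod_cast hq) (Finset.mem_range.mp hi)
    omega
  exact_mod_cast (mul_right_cancel₀ hne key).symm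

/-- The number of `d`-dimensional subspaces between a subspace of dimension `a` and one of
dimension `m`. -/
def intervalCount (q m a d : ℕ) : ℕ := if a ≤ d then gaussBinom q (m - a) (d - a) else 0

theorem finite_Iic_submodule (P : Submodule K V) [FiniteDimensional K P] :
    (Set.Iic P).Finite := by
  have : Finite P := Module.finite_of_finite K
  exact Set.finite_coe_iff.mp (Finite.of_equiv _ (Submodule.mapIic P).toEquiv)

theorem ncard_submodule_between {A P : Submodule K V} [FiniteDimensional K P] (hAP : A ≤ P)
    (d : ℕ) :
    {W : Submodule K V | A ≤ W ∧ W ≤ P ∧ finrank K W = d}.ncard =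
      intervalCount (Fintype.card K) (finrank K P) (finrank K A) d := by
  have : Finite P := Module.finite_of_finite K
  have : Finite (P ⧸ A.submoduleOf P) := Finite.of_surjective _ (Submodule.mkQ_surjective _)
  have hA' : finrank K (A.submoduleOf P) = finrank K A :=
    (Submodule.submoduleOfEquivOfLe hAP).finrank_eq
  have hquot : finrank K (P ⧸ A.submoduleOf P) = finrank K P - finrank K A := by
    have := (A.submoduleOf P).finrank_quotient_add_finrank
    omega
  -- `A ≤ W ≤ P` corresponds to the subspace `W / A` of `P / A`
  let Φ : Submodule K (P ⧸ A.submoduleOf P) → Submodule K V :=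
    fun U => (U.comap (A.submoduleOf P).mkQ).map P.subtype
  have hΦ : Function.Injective Φ :=
    (Submodule.map_injective_of_injective P.injective_subtype).comp
      (Submodule.comap_injective_of_surjective (Submodule.mkQ_surjective _))
  have hfin : ∀ U, finrank K (Φ U) = finrank K U + finrank K A := by
    intro U
    rw [← hA', Submodule.finrank_map_subtype_eq]
    have := ((A.submoduleOf P).mkQ.domRestrict
      (U.comap (A.submoduleOf P).mkQ)).finrank_range_add_finrank_ker
    rw [LinearMap.range_domRestrict,
      Submodule.map_comap_eq_of_surjective (Submodule.mkQ_surjective _),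
      LinearMap.ker_domRestrict, Submodule.ker_mkQ] at this
    rw [← this]
    congr 1
    exact (Submodule.submoduleOfEquivOfLe (Submodule.le_comap_mkQ _ U)).finrank_eq
  have himage : {W : Submodule K V | A ≤ W ∧ W ≤ P ∧ finrank K W = d} =
      Φ '' {U | finrank K U + finrank K A = d} := by
    ext W
    constructor
    · rintro ⟨h1, h2, h3⟩
      have hW : Φ ((W.submoduleOf P).map (A.submoduleOf P).mkQ) = W := by
        have : A.submoduleOf P ≤ W.submoduleOf P := Submodule.comap_mono h1
        simp only [Φ]
        rw [Submodule.comap_map_mkQ, sup_eq_right.mpr this, Submodule.submoduleOf,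
          Submodule.map_comap_subtype, inf_eq_right.mpr h2]
      refine ⟨_, ?_, hW⟩
      rw [Set.mem_ofPred_eq, ← hfin, hW, h3]
    · rintro ⟨U, hU, rfl⟩
      refine ⟨?_, Submodule.map_subtype_le _ _, (hfin U).trans hU⟩
      rw [← inf_eq_right.mpr hAP, ← Submodule.map_comap_subtype]
      exact Submodule.map_mono (Submodule.le_comap_mkQ _ _)
  rw [himage, Set.ncard_image_of_injective _ hΦ, intervalCount]
  split_ifs with had
  · rw [← hquot, ← card_submodule_finrank_eq, ← Nat.card_coe_set_eq]
    refine Nat.card_congr (Equiv.subtypeEquivRight fun U => ?_)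
    simp only [Set.mem_ofPred_eq]
    omega
  · rw [Set.ncard_eq_zero]
    ext U
    simp only [Set.mem_ofPred_eq, Set.mem_empty_iff_false, iff_false]
    omega

end Subspaces

/-! ### Subspaces of polynomials and multiplication by `X` -/

section Shift

variable {K : Type*} [Field K]

/-- The subspace `V ∩ X⁻¹V` of the `p ∈ V` with `X * p ∈ V`. It is the largest subspace `U` with
`U + XU ≤ V`, see `shiftHull_le_iff`. -/
noncomputable def shiftCore (V : Submodule K K[X]) : Submodule K K[X] :=
  V ⊓ V.comap (LinearMap.mulLeft K X)

/-- The sum `V + XV`. -/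
noncomputable def shiftHull (V : Submodule K K[X]) : Submodule K K[X] :=
  V ⊔ V.map (LinearMap.mulLeft K X)

theorem shiftHull_le_iff {U V : Submodule K K[X]} : shiftHull U ≤ V ↔ U ≤ shiftCore V := by
  rw [shiftHull, shiftCore, sup_le_iff, le_inf_iff, Submodule.map_le_iff_le_comap]

theorem mulLeft_X_injective : Function.Injective (LinearMap.mulLeft K (X : K[X])) :=
  fun _ _ h => mul_left_cancel₀ X_ne_zero h

theorem X_mul_mem_degreeLT_iff {k : ℕ} {p : K[X]} :
    X * p ∈ degreeLT K (k + 1) ↔ p ∈ degreeLT K k := by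
  simp only [mem_degreeLT, degree_lt_iff_coeff_zero]
  constructor
  · intro h m hm
    simpa using h (m + 1) (by omega)
  · intro h m hm
    obtain ⟨m, rfl⟩ := Nat.exists_eq_add_one_of_ne_zero (show m ≠ 0 by omega)
    simpa using h m (by omega)

theorem shiftHull_le_degreeLT {U : Submodule K K[X]} {k : ℕ} (hU : U ≤ degreeLT K k) :
    shiftHull U ≤ degreeLT K (k + 1) := by
  refine sup_le (hU.trans (degreeLT_mono (Nat.le_succ k))) ?_
  rintro _ ⟨p, hp, rfl⟩
  exact X_mul_mem_degreeLT_iff.mpr (hU hp)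

theorem shiftCore_le_degreeLT {V : Submodule K K[X]} {k : ℕ} (hV : V ≤ degreeLT K (k + 1)) :
    shiftCore V ≤ degreeLT K k :=
  fun _ hp => X_mul_mem_degreeLT_iff.mp (hV hp.2)

instance finiteDimensional_degreeLT (k : ℕ) : FiniteDimensional K (degreeLT K k) :=
  (degreeLTEquiv K k).symm.finiteDimensional

theorem finrank_degreeLT (k : ℕ) : finrank K (degreeLT K k) = k := by
  simp [(degreeLTEquiv K k).finrank_eq]

theorem finrank_le_of_le_degreeLT {V : Submodule K K[X]} {k : ℕ} (hV : V ≤ degreeLT K k) :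
    finrank K V ≤ k :=
  (Submodule.finrank_mono hV).trans_eq (finrank_degreeLT k)

theorem finiteDimensional_of_le_degreeLT {V : Submodule K K[X]} {k : ℕ} (hV : V ≤ degreeLT K k) :
    FiniteDimensional K V :=
  Submodule.finiteDimensional_of_le hV

theorem finrank_shiftHull_add_finrank_shiftCore (V : Submodule K K[X]) [FiniteDimensional K V] :
    finrank K (shiftHull V) + finrank K (shiftCore V) = 2 * finrank K V := by
  have hinj := mulLeft_X_injective (K := K)
  have h1 := (V.map (LinearMap.mulLeft K X)).finrank_sup_add_finrank_inf_eq V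
  have h2 : V.map (LinearMap.mulLeft K X) ⊓ V = (shiftCore V).map (LinearMap.mulLeft K X) := by
    rw [shiftCore, Submodule.map_inf_eq_map_inf_comap]
  have h3 : ∀ W : Submodule K K[X], finrank K (W.map (LinearMap.mulLeft K X)) = finrank K W :=
    fun W => (Submodule.equivMapOfInjective _ hinj W).finrank_eq.symm
  rw [h2, h3, h3, sup_comm] at h1
  rw [shiftHull]
  omega

theorem finrank_shiftCore_le (V : Submodule K K[X]) [FiniteDimensional K V] :
    finrank K (shiftCore V) ≤ finrank K V :=
  Submodule.finrank_mono inf_le_left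

theorem finrank_shiftHull {V : Submodule K K[X]} [FiniteDimensional K V] :
    finrank K (shiftHull V) = 2 * finrank K V - finrank K (shiftCore V) := by
  have := finrank_shiftHull_add_finrank_shiftCore V
  omega

/-! ### Subspaces counted by the dimension of `V ∩ X⁻¹V` -/

variable (K) in
/-- The set of `d`-dimensional spaces of polynomials of degree less than `k`. -/
def subspacesOfDim (k d : ℕ) : Set (Submodule K K[X]) := {V | V ≤ degreeLT K k ∧ finrank K V = d}

variable (K) in
/-- The number of `d`-dimensional spaces `V` of polynomials of degree less than `k` for which
`V ∩ X⁻¹V` has dimension `f`. -/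
noncomputable def profileCount (k d f : ℕ) : ℕ :=
  {V ∈ subspacesOfDim K k d | finrank K (shiftCore V) = f}.ncard

theorem profileCount_zero : profileCount K 0 0 0 = 1 := by
  have h0 : degreeLT K 0 = ⊥ := by
    rw [← Submodule.finrank_eq_zero (R := K), finrank_degreeLT]
  rw [profileCount, Set.ncard_eq_one]
  refine ⟨⊥, ?_⟩
  ext V
  simp only [Set.mem_ofPred_eq, Set.mem_singleton_iff, subspacesOfDim, h0, le_bot_iff]
  refine ⟨fun h => h.1.1, ?_⟩
  rintro rfl
  have h : shiftCore (⊥ : Submodule K K[X]) = ⊥ := le_bot_iff.mp inf_le_left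
  exact ⟨⟨rfl, finrank_bot K K[X]⟩, by rw [h, finrank_bot]⟩

variable [Fintype K]

theorem finite_subspacesOfDim (k d : ℕ) : (subspacesOfDim K k d).Finite :=
  (finite_Iic_submodule (degreeLT K k)).subset fun _ h => h.1

/-- A sum over the `d`-dimensional spaces of polynomials of a function of `dim (V ∩ X⁻¹V)`. -/
theorem sum_subspacesOfDim_eq (k d : ℕ) (F : ℕ → ℕ) :
    ∑ V ∈ (finite_subspacesOfDim (K := K) k d).toFinset, F (finrank K (shiftCore V)) =
      ∑ f ∈ Finset.range (d + 1), profileCount K k d f * F f := by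
  classical
  rw [← Finset.sum_fiberwise_of_maps_to (t := Finset.range (d + 1))
    (g := fun V => finrank K (shiftCore V))]
  · refine Finset.sum_congr rfl fun f _ => ?_
    rw [Finset.sum_congr rfl (g := fun _ => F f)
      (fun V hV => by rw [(Finset.mem_filter.mp hV).2]), Finset.sum_const, smul_eq_mul]
    congr 1
    rw [profileCount, ← Set.ncard_coe_finset]
    congr 1
    ext V
    simp
  · intro V hV
    obtain ⟨h1, h2⟩ := (Set.Finite.mem_toFinset _).mp hV
    have := finiteDimensional_of_le_degreeLT h1
    have := finrank_shiftCore_le V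
    rw [Finset.mem_range]
    omega

/-- Double counting of the pairs `U ≤ V ∩ X⁻¹V`, equivalently `U + XU ≤ V`, with `dim U = g` and
`dim V = d`. -/
theorem profileCount_succ (k d g : ℕ) :
    ∑ f ∈ Finset.range (d + 1), profileCount K (k + 1) d f * gaussBinom (Fintype.card K) f g =
      ∑ f ∈ Finset.range (g + 1),
        profileCount K k g f * intervalCount (Fintype.card K) (k + 1) (2 * g - f) d := by
  classical
  have key := Finset.sum_card_bipartiteAbove_eq_sum_card_bipartiteBelow
    (s := (finite_subspacesOfDim (K := K) (k + 1) d).toFinset)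
    (t := (finite_subspacesOfDim (K := K) k g).toFinset) (fun V U => U ≤ shiftCore V)
  rw [← sum_subspacesOfDim_eq (K := K) (k + 1) d (fun f => gaussBinom (Fintype.card K) f g),
    ← sum_subspacesOfDim_eq (K := K) k g
      (fun f => intervalCount (Fintype.card K) (k + 1) (2 * g - f) d)]
  convert key using 1
  · refine Finset.sum_congr rfl fun V hV => ?_
    obtain ⟨h1, h2⟩ := (Set.Finite.mem_toFinset _).mp hV
    have hcore := shiftCore_le_degreeLT h1
    have := finiteDimensional_of_le_degreeLT hcore
    have hcount := ncard_submodule_between (K := K) (bot_le : ⊥ ≤ shiftCore V) g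
    rw [finrank_bot, intervalCount, if_pos (Nat.zero_le g)] at hcount
    rw [Nat.sub_zero, Nat.sub_zero] at hcount
    rw [← hcount, ← Set.ncard_coe_finset]
    congr 1
    ext U
    simp only [Finset.coe_bipartiteAbove, Set.Finite.mem_toFinset, subspacesOfDim,
      Set.mem_ofPred_eq, bot_le, true_and]
    exact ⟨fun h => ⟨⟨h.1.trans hcore, h.2⟩, h.1⟩, fun h => ⟨h.2, h.1.2⟩⟩
  · refine Finset.sum_congr rfl fun U hU => ?_
    obtain ⟨h1, h2⟩ := (Set.Finite.mem_toFinset _).mp hU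
    have := finiteDimensional_of_le_degreeLT h1
    have hcount := ncard_submodule_between (K := K) (shiftHull_le_degreeLT h1) d
    rw [finrank_degreeLT, finrank_shiftHull, h2] at hcount
    rw [← hcount, ← Set.ncard_coe_finset]
    congr 1
    ext V
    simp only [Finset.coe_bipartiteBelow, Set.Finite.mem_toFinset, subspacesOfDim,
      Set.mem_ofPred_eq, shiftHull_le_iff]
    exact ⟨fun h => ⟨h.2, h.1⟩, fun h => ⟨h.2, h.1⟩⟩

theorem profileCount_eq_zero_of_dim_lt {k d : ℕ} (f : ℕ) (h : k < d) :
    profileCount K k d f = 0 := by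
  rw [profileCount, Set.ncard_eq_zero ((finite_subspacesOfDim k d).subset fun _ h => h.1)]
  ext V
  simp only [Set.mem_ofPred_eq, Set.mem_empty_iff_false, iff_false]
  rintro ⟨⟨h1, h2⟩, h3⟩
  have := finrank_le_of_le_degreeLT h1
  omega

end Shift

/-- The closed form `q ^ (r (r - 1)) [d - 1 choose r - 1] [k + 1 - d choose r]` with `r = d - f` for
`profileCount K k d f`, where `q = |K|` and `f ≤ d`. It is a `q`-analogue of the number of
`d`-element subsets of `{1, …, k}` that consist of `r` runs of consecutive elements. The first
binomial is written `[d - 1 choose f]`, which is also correct for `d = 0`, where `f = r = 0` and the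
value is `1`. -/
def profileFormula (q k d f : ℕ) : ℕ :=
  q ^ ((d - f) * (d - f - 1)) * (gaussBinom q (d - 1) f * gaussBinom q (k + 1 - d) (d - f))

theorem profileFormula_eq_zero_of_lt (q : ℕ) {k d f : ℕ} (h : k < d) (hf : f ≤ d) :
    profileFormula q k d f = 0 := by
  rcases hf.lt_or_eq with hf | rfl
  · simp [profileFormula, gaussBinom_eq_zero_of_lt q (show k + 1 - d < d - f by omega)]
  · simp [profileFormula, gaussBinom_eq_zero_of_lt q (show f - 1 < f by omega)]

/-- The values `profileFormula` satisfy the recursion `profileCount_succ` for `q = 2`, in the range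
needed for matrices with ten columns. -/
theorem profileFormula_succ : ∀ k < 10, ∀ d ≤ k + 1, ∀ g ≤ d,
    ∑ f ∈ Finset.range (d + 1), profileFormula 2 (k + 1) d f * gaussBinom 2 f g =
      ∑ f ∈ Finset.range (g + 1),
        profileFormula 2 k g f * intervalCount 2 (k + 1) (2 * g - f) d := by
  decide +kernel

theorem profileCount_eq_profileFormula {k : ℕ} (hk : k ≤ 10) {d f : ℕ} (hd : d ≤ k)
    (hf : f ≤ d) :
    profileCount (ZMod 2) k d f = profileFormula 2 k d f := by
  induction k generalizing d f with
  | zero =>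
    obtain rfl : d = 0 := by omega
    obtain rfl : f = 0 := by omega
    rw [profileCount_zero]
    rfl
  | succ k ih =>
    have h := eq_of_sum_mul_gaussBinom_eq (q := 2) (N := d)
      (a := fun f => profileCount (ZMod 2) (k + 1) d f)
      (b := fun f => profileFormula 2 (k + 1) d f) ?_ f hf
    · exact_mod_cast h
    intro g hg
    have h1 := profileCount_succ (K := ZMod 2) k d g
    rw [ZMod.card] at h1
    have h2 := profileFormula_succ k (by omega) d hd g hg
    have h3 : ∀ f ∈ Finset.range (g + 1),
        profileCount (ZMod 2) k g f * intervalCount 2 (k + 1) (2 * g - f) d =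
          profileFormula 2 k g f * intervalCount 2 (k + 1) (2 * g - f) d := by
      intro f hf
      rcases Nat.lt_or_ge k g with hgk | hgk
      · rw [profileCount_eq_zero_of_dim_lt f hgk,
          profileFormula_eq_zero_of_lt 2 hgk (by simp at hf; omega)]
      · rw [ih (by omega) hgk (by simp at hf; omega)]
    rw [Finset.sum_congr rfl h3, ← h2] at h1
    exact_mod_cast h1

/-! ### Coefficient functionals and kernels of persymmetric matrices -/

section Pairing

variable {K : Type*} [Field K]

/-- The functional `p ↦ ∑ c, a c * p.coeff c` on polynomials. -/
noncomputable def coeffFunctional {m : ℕ} (a : Fin m → K) : K[X] →ₗ[K] K :=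
  ∑ c, a c • lcoeff K c

theorem coeffFunctional_apply {m : ℕ} (a : Fin m → K) (p : K[X]) :
    coeffFunctional a p = ∑ c, a c * p.coeff c := by
  simp [coeffFunctional]

/-- Every functional on the polynomials of degree less than `m` is given by its coefficients. -/
noncomputable def coeffFunctionalEquiv (m : ℕ) : (Fin m → K) ≃ₗ[K] Dual K (degreeLT K m) :=
  (dotProductEquiv K (Fin m)).trans (degreeLTEquiv K m).dualMap

theorem coeffFunctionalEquiv_apply {m : ℕ} (a : Fin m → K) (p : degreeLT K m) :
    coeffFunctionalEquiv m a p = coeffFunctional a p := by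
  rw [coeffFunctional_apply]
  rfl

/-- A space `W` of polynomials of degree less than `m` has an annihilator of dimension
`m - dim W`. -/
theorem card_coeffFunctional_annihilator [Fintype K] {m : ℕ} {W : Submodule K K[X]}
    (hW : W ≤ degreeLT K m) :
    Nat.card {a : Fin m → K // W ≤ LinearMap.ker (coeffFunctional a)} =
      Fintype.card K ^ (m - finrank K W) := by
  have h1 := Subspace.finrank_add_finrank_dualAnnihilator_eq (W.submoduleOf (degreeLT K m))
  rw [(Submodule.submoduleOfEquivOfLe hW).finrank_eq, finrank_degreeLT] at h1
  have h2 : Nat.card (W.submoduleOf (degreeLT K m)).dualAnnihilator =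
      Fintype.card K ^ (m - finrank K W) := by
    rw [Module.natCard_eq_pow_finrank (K := K), Nat.card_eq_fintype_card]
    congr 1
    omega
  rw [← h2]
  refine Nat.card_congr ((coeffFunctionalEquiv m).toEquiv.subtypeEquiv fun a => ?_)
  simp only [LinearEquiv.coe_toEquiv]
  rw [Submodule.mem_dualAnnihilator]
  constructor
  · intro h p hp
    rw [coeffFunctionalEquiv_apply]
    exact h hp
  · intro h p hp
    have := h ⟨p, hW hp⟩ hp
    rwa [coeffFunctionalEquiv_apply] at this

/-- The polynomials `p` of degree less than `k` such that all the functionals with coefficients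
`α j` vanish at `p` and at `X * p`. -/
noncomputable def kernelSpace {ι : Type*} {k : ℕ} (α : ι → Fin (k + 1) → K) :
    Submodule K K[X] :=
  degreeLT K k ⊓ ⨅ j, shiftCore (LinearMap.ker (coeffFunctional (α j)))

theorem kernelSpace_le {ι : Type*} {k : ℕ} (α : ι → Fin (k + 1) → K) :
    kernelSpace α ≤ degreeLT K k := inf_le_left

theorem le_kernelSpace_iff {ι : Type*} {k : ℕ} {α : ι → Fin (k + 1) → K} {U : Submodule K K[X]}
    (hU : U ≤ degreeLT K k) :
    U ≤ kernelSpace α ↔ ∀ j, shiftHull U ≤ LinearMap.ker (coeffFunctional (α j)) := by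
  simp only [kernelSpace, le_inf_iff, le_iInf_iff, shiftHull_le_iff, hU, true_and]

theorem card_le_kernelSpace [Fintype K] (n : ℕ) {k : ℕ} {U : Submodule K K[X]}
    (hU : U ≤ degreeLT K k) :
    Nat.card {α : Fin n → Fin (k + 1) → K // U ≤ kernelSpace α} =
      Fintype.card K ^ (n * (k + 1 - finrank K (shiftHull U))) := by
  rw [Nat.card_congr (Equiv.subtypeEquivRight fun α => le_kernelSpace_iff (α := α) hU),
    Nat.card_congr (Equiv.subtypePiEquivPi
      (p := fun (_ : Fin n) (a : Fin (k + 1) → K) =>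
        shiftHull U ≤ LinearMap.ker (coeffFunctional a))), Nat.card_pi]
  simp [card_coeffFunctional_annihilator (shiftHull_le_degreeLT hU), ← pow_mul, mul_comm]

/-- Double counting of the pairs `(V, α)` with `V` a `d`-dimensional subspace of
`kernelSpace α`. -/
theorem sum_gaussBinom_finrank_kernelSpace [Fintype K] (n k d : ℕ) :
    ∑ α : Fin n → Fin (k + 1) → K, gaussBinom (Fintype.card K) (finrank K (kernelSpace α)) d =
      ∑ f ∈ Finset.range (d + 1),
        profileCount K k d f * Fintype.card K ^ (n * (k + 1 - (2 * d - f))) := by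
  classical
  have key := Finset.sum_card_bipartiteAbove_eq_sum_card_bipartiteBelow
    (s := (Finset.univ : Finset (Fin n → Fin (k + 1) → K)))
    (t := (finite_subspacesOfDim (K := K) k d).toFinset) (fun α U => U ≤ kernelSpace α)
  rw [← sum_subspacesOfDim_eq (K := K) k d
    (fun f => Fintype.card K ^ (n * (k + 1 - (2 * d - f))))]
  convert key using 1
  · refine Finset.sum_congr rfl fun α _ => ?_
    have hle := kernelSpace_le α
    have := finiteDimensional_of_le_degreeLT hle
    have hcount := ncard_submodule_between (K := K) (bot_le : ⊥ ≤ kernelSpace α) d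
    rw [finrank_bot, intervalCount, if_pos (Nat.zero_le d), Nat.sub_zero, Nat.sub_zero] at hcount
    rw [← hcount, ← Set.ncard_coe_finset]
    congr 1
    ext U
    simp only [Finset.coe_bipartiteAbove, Set.Finite.mem_toFinset, subspacesOfDim,
      Set.mem_ofPred_eq, bot_le, true_and]
    exact ⟨fun h => ⟨⟨h.1.trans hle, h.2⟩, h.1⟩, fun h => ⟨h.2, h.1.2⟩⟩
  · refine Finset.sum_congr rfl fun U hU => ?_
    obtain ⟨h1, h2⟩ := (Set.Finite.mem_toFinset _).mp hU
    have := finiteDimensional_of_le_degreeLT h1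
    have hcount := card_le_kernelSpace n h1
    rw [finrank_shiftHull, h2] at hcount
    rw [← hcount, Finset.bipartiteBelow, Nat.card_eq_fintype_card, Fintype.card_subtype]

end Pairing

/-! ### The rank distribution -/

/-- The vectors in the kernel of an `n`-times persymmetric matrix are the coefficient vectors of the
polynomials in `kernelSpace`: in a block, the first row pairs with `p` and the second with
`X * p`. -/
theorem mem_kernelSpace_degreeLTEquiv_symm (n k : ℕ) (α : Fin n → Fin (k + 1) → ZMod 2)
    (x : Fin k → ZMod 2) :
    ((degreeLTEquiv (ZMod 2) k).symm x : (ZMod 2)[X]) ∈ kernelSpace α ↔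
      (nTimesPersymmetric n k α).mulVec x = 0 := by
  set p := (degreeLTEquiv (ZMod 2) k).symm x with hp
  have hx : ∀ c : Fin k, (p : (ZMod 2)[X]).coeff c = x c :=
    fun c => congrFun ((degreeLTEquiv (ZMod 2) k).apply_symm_apply x) c
  have hk : (p : (ZMod 2)[X]).coeff k = 0 :=
    degree_lt_iff_coeff_zero _ _ |>.mp (mem_degreeLT.mp p.2) k le_rfl
  have h0 : ∀ a : Fin (k + 1) → ZMod 2,
      coeffFunctional a (p : (ZMod 2)[X]) = ∑ c : Fin k, a c.castSucc * x c := by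
    intro a
    rw [coeffFunctional_apply, Fin.sum_univ_castSucc]
    simp [hx, hk]
  have h1 : ∀ a : Fin (k + 1) → ZMod 2,
      coeffFunctional a (X * (p : (ZMod 2)[X])) = ∑ c : Fin k, a c.succ * x c := by
    intro a
    rw [coeffFunctional_apply, Fin.sum_univ_succ]
    simp [hx]
  simp only [kernelSpace, shiftCore, Submodule.mem_inf, Submodule.mem_iInf, p.2, true_and,
    Submodule.mem_comap, LinearMap.mem_ker, LinearMap.mulLeft_apply, h0, h1]
  constructor
  · intro h
    funext ⟨j, r⟩
    fin_cases r
    · exact (h j).1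
    · exact (h j).2
  · intro h j
    exact ⟨congrFun h (j, 0), congrFun h (j, 1)⟩

theorem finrank_kernelSpace_add_rank (n k : ℕ) (α : Fin n → Fin (k + 1) → ZMod 2) :
    finrank (ZMod 2) (kernelSpace α) + (nTimesPersymmetric n k α).rank = k := by
  have h1 := (nTimesPersymmetric n k α).mulVecLin.finrank_range_add_finrank_ker
  have h2 : kernelSpace α = (LinearMap.ker (nTimesPersymmetric n k α).mulVecLin).map
      ((degreeLT (ZMod 2) k).subtype ∘ₗ (degreeLTEquiv (ZMod 2) k).symm.toLinearMap) := by
    ext p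
    constructor
    · intro hp
      refine ⟨degreeLTEquiv (ZMod 2) k ⟨p, kernelSpace_le α hp⟩, ?_, by simp⟩
      rw [SetLike.mem_coe, LinearMap.mem_ker, Matrix.mulVecLin_apply,
        ← mem_kernelSpace_degreeLTEquiv_symm]
      simpa using hp
    · rintro ⟨x, hx, rfl⟩
      exact (mem_kernelSpace_degreeLTEquiv_symm n k α x).mpr hx
  have h3 : Function.Injective
      ((degreeLT (ZMod 2) k).subtype ∘ₗ (degreeLTEquiv (ZMod 2) k).symm.toLinearMap) :=
    (Submodule.injective_subtype _).comp (LinearEquiv.injective _)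
  rw [h2, ← (Submodule.equivMapOfInjective _ h3 _).finrank_eq, Matrix.rank]
  simp at h1
  omega

theorem nTimesPersymmetric_injective (n : ℕ) {k : ℕ} (hk : 0 < k) :
    Function.Injective (nTimesPersymmetric n k) := by
  intro α β h
  funext j m
  rcases Nat.lt_or_ge (m : ℕ) k with hm | hm
  · exact congrFun (congrFun h (j, 0)) ⟨m, hm⟩
  · have := congrFun (congrFun h (j, 1)) ⟨k - 1, by omega⟩
    simp only [nTimesPersymmetric, Matrix.of_apply, Fin.val_one] at this
    convert this using 2 <;> exact Fin.ext (by simp; omega)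

theorem rankCount_eq_card (n : ℕ) {k : ℕ} (hk : 0 < k) (i : ℕ) :
    rankCount n k i =
      (Finset.univ.filter fun α : Fin n → Fin (k + 1) → ZMod 2 =>
        (nTimesPersymmetric n k α).rank = i).card := by
  rw [rankCount, ← Set.ncard_coe_finset,
    ← Set.ncard_image_of_injective _ (nTimesPersymmetric_injective n hk)]
  congr 1
  ext M
  constructor
  · rintro ⟨⟨α, rfl⟩, h⟩
    exact ⟨α, by simpa using h, rfl⟩
  · rintro ⟨α, h, rfl⟩
    exact ⟨⟨α, rfl⟩, by simpa using h⟩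

/-- A sum over all `α` of a function of the dimension of the kernel, ordered by the rank. -/
theorem sum_finrank_kernelSpace_eq (n : ℕ) {k : ℕ} (hk : 0 < k) (F : ℕ → ℕ) :
    ∑ α : Fin n → Fin (k + 1) → ZMod 2, F (finrank (ZMod 2) (kernelSpace α)) =
      ∑ f ∈ Finset.range (k + 1), rankCount n k (k - f) * F f := by
  rw [← Finset.sum_fiberwise_of_maps_to (t := Finset.range (k + 1))
    (g := fun α => finrank (ZMod 2) (kernelSpace α))]
  · refine Finset.sum_congr rfl fun f hf => ?_
    rw [Finset.sum_congr rfl (g := fun _ => F f)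
      (fun V hV => by rw [(Finset.mem_filter.mp hV).2]), Finset.sum_const, smul_eq_mul,
      rankCount_eq_card n hk]
    congr 2
    ext α
    have := finrank_kernelSpace_add_rank n k α
    simp at hf ⊢
    omega
  · intro α _
    have := finrank_kernelSpace_add_rank n k α
    rw [Finset.mem_range]
    omega

/-- The moments of the rank distribution for ten columns. -/
theorem sum_rankCount_mul_gaussBinom (n : ℕ) {d : ℕ} (hd : d ≤ 10) :
    ∑ f ∈ Finset.range 11, rankCount n 10 (10 - f) * gaussBinom 2 f d =
      ∑ f ∈ Finset.range (d + 1), profileFormula 2 10 d f * 2 ^ (n * (11 - (2 * d - f))) := by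
  rw [← sum_finrank_kernelSpace_eq n (by norm_num) (fun f => gaussBinom 2 f d)]
  have := sum_gaussBinom_finrank_kernelSpace (K := ZMod 2) n 10 d
  rw [ZMod.card] at this
  rw [this]
  refine Finset.sum_congr rfl fun f hf => ?_
  rw [profileCount_eq_profileFormula le_rfl hd (by simp at hf; omega)]

/-- The explicit values satisfy the same linear equations as the rank counts; an identity of
polynomials in `2 ^ n` for each `d`. -/
theorem sum_rankFormula_mul_gaussBinom (n : ℕ) {d : ℕ} (hd : d ≤ 10) :
    ∑ f ∈ Finset.range 11, rankFormula n (10 - f) * (gaussBinom 2 f d : ℤ) =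
      ∑ f ∈ Finset.range (d + 1),
        (profileFormula 2 10 d f : ℤ) * 2 ^ (n * (11 - (2 * d - f))) := by
  interval_cases d <;>
    simp [Finset.sum_range_succ, rankFormula, profileFormula, gaussBinom] <;>
    ring

theorem rankCount_eq_rankFormula (n : ℕ) {i : ℕ} (hi : i ≤ 10) :
    (rankCount n 10 i : ℤ) = rankFormula n i := by
  have h := eq_of_sum_mul_gaussBinom_eq (q := 2) (N := 10)
    (a := fun f => (rankCount n 10 (10 - f) : ℤ)) (b := fun f => rankFormula n (10 - f))
    (fun g hg => ?_) (10 - i) (by omega)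
  · simpa [Nat.sub_sub_self hi] using h
  · rw [sum_rankFormula_mul_gaussBinom n hg]
    exact_mod_cast sum_rankCount_mul_gaussBinom n hg

/-! ### Linear relations with coefficients of degree at most one -/

section Relations

variable {K : Type*} [Field K]

/-- The relations `∑ i, Y i * u i = 0` whose coefficients `u i` have degree at most one. -/
def linearRelations {q : ℕ} (Y : Fin q → K[X]) : Set (Fin q → K[X]) :=
  {u | (∀ i, (u i).degree ≤ 1) ∧ ∑ i, Y i * u i = 0}

/-- The map `(a, b) ↦ ∑ i, Y i * (a i + b i * X)`. -/
noncomputable def linearRelationMap {q : ℕ} (Y : Fin q → K[X]) :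
    (Fin q → K) × (Fin q → K) →ₗ[K] K[X] :=
  (Fintype.linearCombination K Y).coprod
    (LinearMap.mulLeft K X ∘ₗ Fintype.linearCombination K Y)

theorem range_linearRelationMap {q : ℕ} (Y : Fin q → K[X]) :
    LinearMap.range (linearRelationMap Y) = shiftHull (Submodule.span K (Set.range Y)) := by
  rw [linearRelationMap, LinearMap.range_coprod, LinearMap.range_comp,
    Fintype.range_linearCombination, shiftHull]

theorem linearRelationMap_apply {q : ℕ} (Y : Fin q → K[X]) (a b : Fin q → K) :
    linearRelationMap Y (a, b) = ∑ i, Y i * (C (b i) * X + C (a i)) := by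
  simp only [linearRelationMap, LinearMap.coprod_apply, LinearMap.comp_apply,
    Fintype.linearCombination_apply, LinearMap.mulLeft_apply, Finset.mul_sum,
    ← Finset.sum_add_distrib, smul_eq_C_mul]
  exact Finset.sum_congr rfl fun i _ => by ring

/-- A relation is determined by the constant and the linear coefficients of its entries. -/
noncomputable def kerLinearRelationMapEquiv {q : ℕ} (Y : Fin q → K[X]) :
    LinearMap.ker (linearRelationMap Y) ≃ linearRelations Y where
  toFun x := ⟨fun i => C (x.1.2 i) * X + C (x.1.1 i), fun _ => degree_linear_le, by
    rw [← linearRelationMap_apply]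
    exact x.2⟩
  invFun u := ⟨(fun i => (u.1 i).coeff 0, fun i => (u.1 i).coeff 1), by
    rw [LinearMap.mem_ker, linearRelationMap_apply]
    rw [Finset.sum_congr rfl fun i _ => by rw [← eq_X_add_C_of_degree_le_one (u.2.1 i)]]
    exact u.2.2⟩
  left_inv x := by
    ext i <;> simp
  right_inv u := by
    refine Subtype.ext (funext fun i => ?_)
    exact (eq_X_add_C_of_degree_le_one (u.2.1 i)).symm

theorem finrank_ker_linearRelationMap {q : ℕ} (Y : Fin q → K[X]) :
    finrank K (shiftHull (Submodule.span K (Set.range Y))) +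
      finrank K (LinearMap.ker (linearRelationMap Y)) = 2 * q := by
  rw [← range_linearRelationMap, LinearMap.finrank_range_add_finrank_ker]
  simp
  ring

theorem card_linearRelations [Fintype K] {q : ℕ} (Y : Fin q → K[X]) :
    Nat.card (linearRelations Y) = Fintype.card K ^
      (2 * q - finrank K (shiftHull (Submodule.span K (Set.range Y)))) := by
  have := finrank_ker_linearRelationMap Y
  rw [← Nat.card_congr (kerLinearRelationMapEquiv Y), Module.natCard_eq_pow_finrank (K := K),
    Nat.card_eq_fintype_card]
  congr 1
  omega

/-- The tuples in `P` whose span lies in `W` are the tuples of elements of `W`. -/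
theorem card_tuples_mem [Fintype K] (q : ℕ) {P W : Submodule K K[X]} [FiniteDimensional K P]
    (hW : W ≤ P) :
    Nat.card {Y : Fin q → P // Submodule.span K (Set.range fun i => (Y i : K[X])) ≤ W} =
      Fintype.card K ^ (q * finrank K W) := by
  have h : ∀ Y : Fin q → P, Submodule.span K (Set.range fun i => (Y i : K[X])) ≤ W ↔
      ∀ i, Y i ∈ W.submoduleOf P := by
    intro Y
    rw [Submodule.span_le, Set.range_subset_iff]
    rfl
  have : FiniteDimensional K W := Submodule.finiteDimensional_of_le hW
  rw [Nat.card_congr (Equiv.subtypeEquivRight h), Nat.card_congr (Equiv.subtypePiEquivPi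
      (p := fun (_ : Fin q) (y : P) => y ∈ W.submoduleOf P)), Nat.card_pi]
  have h2 : Nat.card {y // y ∈ W.submoduleOf P} = Fintype.card K ^ finrank K W := by
    rw [Nat.card_congr (Submodule.submoduleOfEquivOfLe hW).toEquiv,
      Module.natCard_eq_pow_finrank (K := K), Nat.card_eq_fintype_card]
  simp [h2, ← pow_mul, mul_comm]

end Relations

theorem solutionCount_eq_sum (q n k : ℕ) [Fintype (degreeLT (ZMod 2) k)] :
    solutionCount q n k = ∑ Y : Fin q → degreeLT (ZMod 2) k,
      2 ^ (n * (2 * q - finrank (ZMod 2)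
        (shiftHull (Submodule.span (ZMod 2) (Set.range fun i => (Y i : (ZMod 2)[X])))))) := by
  have e : {s : (Fin q → (ZMod 2)[X]) × (Fin n → Fin q → (ZMod 2)[X]) |
      (∀ i, (s.1 i).degree < (k : WithBot ℕ)) ∧
      (∀ j i, (s.2 j i).degree ≤ (1 : WithBot ℕ)) ∧
      ∀ j, ∑ i, s.1 i * s.2 j i = 0} ≃
      Σ Y : Fin q → degreeLT (ZMod 2) k,
        (Fin n → linearRelations fun i => (Y i : (ZMod 2)[X])) :=
    { toFun := fun s => ⟨fun i => ⟨s.1.1 i, mem_degreeLT.mpr (s.2.1 i)⟩,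
        fun j => ⟨s.1.2 j, s.2.2.1 j, s.2.2.2 j⟩⟩
      invFun := fun x => ⟨(fun i => x.1 i, fun j => x.2 j),
        fun i => mem_degreeLT.mp (x.1 i).2, fun j => (x.2 j).2.1, fun j => (x.2 j).2.2⟩
      left_inv := fun s => rfl
      right_inv := fun x => rfl }
  have hfin : ∀ Y : Fin q → degreeLT (ZMod 2) k,
      Finite (linearRelations fun i => (Y i : (ZMod 2)[X])) := by
    intro Y
    have : Finite (LinearMap.ker (linearRelationMap fun i => (Y i : (ZMod 2)[X]))) :=
      Module.finite_of_finite (ZMod 2)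
    exact Finite.of_equiv _ (kerLinearRelationMapEquiv _)
  rw [solutionCount, ← Nat.card_coe_set_eq, Nat.card_congr e, Nat.card_sigma]
  refine Finset.sum_congr rfl fun Y _ => ?_
  rw [Nat.card_pi, Finset.prod_const, card_linearRelations, ZMod.card, ← pow_mul,
    Finset.card_univ, Fintype.card_fin, mul_comm n]

/-- Double counting of the pairs `(Y, α)` with all the entries of `Y` in `kernelSpace α`: summing
over `Y` gives a multiple of the number of solutions, summing over `α` a moment of the rank
distribution. -/
theorem solutionCount_eq_sum_rankCount (q n : ℕ) {k : ℕ} (hk : 0 < k) (hq : 2 * q ≤ k + 1) :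
    2 ^ (n * (k + 1 - 2 * q)) * solutionCount q n k =
      ∑ f ∈ Finset.range (k + 1), rankCount n k (k - f) * 2 ^ (q * f) := by
  classical
  have : Finite (degreeLT (ZMod 2) k) := Module.finite_of_finite (ZMod 2)
  have : Fintype (degreeLT (ZMod 2) k) := Fintype.ofFinite _
  rw [← sum_finrank_kernelSpace_eq n hk (fun f => 2 ^ (q * f)), solutionCount_eq_sum,
    Finset.mul_sum]
  have key := Finset.sum_card_bipartiteAbove_eq_sum_card_bipartiteBelow
    (s := (Finset.univ : Finset (Fin q → degreeLT (ZMod 2) k)))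
    (t := (Finset.univ : Finset (Fin n → Fin (k + 1) → ZMod 2)))
    (fun Y α => Submodule.span (ZMod 2) (Set.range fun i => (Y i : (ZMod 2)[X])) ≤ kernelSpace α)
  convert key using 1
  · refine Finset.sum_congr rfl fun Y _ => ?_
    have hle : Submodule.span (ZMod 2) (Set.range fun i => (Y i : (ZMod 2)[X])) ≤
        degreeLT (ZMod 2) k := by
      rw [Submodule.span_le, Set.range_subset_iff]
      exact fun i => (Y i).2
    have hcount := card_le_kernelSpace n hle
    have hdim := finrank_ker_linearRelationMap fun i => (Y i : (ZMod 2)[X])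
    rw [Finset.bipartiteAbove, ← Fintype.card_subtype, ← Nat.card_eq_fintype_card, hcount,
      ZMod.card, ← pow_add, ← mul_add]
    congr 2
    omega
  · refine Finset.sum_congr rfl fun α _ => ?_
    have hcount := card_tuples_mem q (kernelSpace_le α)
    rw [Finset.bipartiteBelow, ← Fintype.card_subtype, ← Nat.card_eq_fintype_card, hcount,
      ZMod.card]

theorem mainTheorem1 (n : ℕ) (hn : 1 ≤ n) :
    (∀ i : ℕ, i ≤ min (2 * n) 10 → (rankCount n 10 i : ℤ) = rankFormula n i) ∧
    solutionCount 4 n 10 =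
      2 ^ (8 * n) + 15345 * 2 ^ (6 * n) + 107310 * 2 ^ (5 * n) + 37128000 * 2 ^ (4 * n)
        + 329001120 * 2 ^ (3 * n) + 67088385 * 2 ^ 8 * 2 ^ (2 * n)
        + 26043255 * 2 ^ 12 * 2 ^ n + 2 ^ 16 * 14881860 := by
  refine ⟨fun _ hi => rankCount_eq_rankFormula n (hi.trans (min_le_right _ _)), ?_⟩
  have h := congrArg (Nat.cast : ℕ → ℤ)
    (solutionCount_eq_sum_rankCount 4 n (k := 10) (by norm_num) (by norm_num))
  push_cast at h
  rw [Finset.sum_congr rfl fun f _ => by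
    rw [rankCount_eq_rankFormula n (i := 10 - f) (by omega)]] at h
  -- both sides are compared after multiplication by `2 ^ (3 * n)`
  refine Int.natCast_inj.mp (mul_left_cancel₀ (b := (solutionCount 4 n 10 : ℤ))
    (pow_ne_zero (n * (10 + 1 - 2 * 4)) (two_ne_zero (α := ℤ))) (h.trans ?_))
  simp [Finset.sum_range_succ, rankFormula]
  ring
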